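/- A finite simple graph $G$ is a threshold graph if there are a nonnegative function $f:V(G)\to\mathbb{R}$ and a real number $t\ge 0$ such that any two distinct vertices $u,v$ are adjacent if and only if $f(u)+f(v)>t$. A Hamilton cycle of a graph is a cycle subgraph through all its vertices, and a graph of order at least $3$ is hamiltonian if it has a Hamilton cycle. For every integer $n\ge 3$ there is, up to isomorphism, exactly one graph $G_n$ with degree sequence $n-1,\,n-1,\,n-2,\,\ldots,\,\lceil n/2\rceil,\,\lceil n/2\rceil,\,\ldots,\,3,\,2$, that is, the sequence in which each of $2,3,\ldots,n-1$ occurs once, and $n-1$ and $\lceil n/2\rceil$ each occur once more; it has $n-2$ distinct degrees. Explicitly, $G_n$ is the graph on $\{1,\ldots,n\}$ in which distinct $i,j$ are adjacent if and only if $i+j\ge n$. Theorem. For every integer $n\ge 3$, $G_n$ is a hamiltonian threshold graph, and the minimum number of Hamilton cycles in a hamiltonian threshold graph of order $n$ is $2^{\lfloor (n-3)/2\rfloor}$. A hamiltonian threshold graph of order $n$ has exactly $2^{\lfloor (n-3)/2\rfloor}$ Hamilton cycles if and only if it is isomorphic to $G_n$. Moreover, if $f(n)$ denotes the number of Hamilton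 cycles of $G_n$, then $f(2k-1)=f(2k)$ and $f(2k+1)=2f(2k)$ for every integer $k\ge 2$. -/

import Mathlib

/-- A graph is a threshold graph if there are a nonnegative real weight function `f` on its
vertices and a nonnegative real `t` such that distinct vertices `u`, `v` are adjacent if and only
if `f u + f v > t`. -/
def IsThresholdGraph {V : Type*} (G : SimpleGraph V) : Prop :=
  ∃ (f : V → ℝ) (t : ℝ), (∀ v, 0 ≤ f v) ∧ 0 ≤ t ∧ ∀ u v, u ≠ v → (G.Adj u v ↔ f u + f v > t)

open Classical in
/-- The Hamilton cycles of `G`. A Hamilton cycle is a subgraph, determined by its set of edges;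
it is the same cycle whatever starting vertex and direction are used to run through it. -/
def hamiltonCycles {V : Type*} (G : SimpleGraph V) : Set (Set (Sym2 V)) :=
  {C | ∃ (a : V) (p : G.Walk a a), p.IsHamiltonianCycle ∧ p.edgeSet = C}

/-- The number of Hamilton cycles of `G` (used for finite graphs only). -/
noncomputable def numHamiltonCycles {V : Type*} (G : SimpleGraph V) : ℕ :=
  (hamiltonCycles G).ncard

open Classical in
/-- The degree sequence of a finite graph, up to order: the multiset of its vertex degrees. -/
noncomputable def degreeSequence {V : Type*} [Fintype V] (G : SimpleGraph V) : Multiset ℕ :=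
  Finset.univ.val.map fun v => G.degree v

/-- The sequence `n-1, n-1, n-2, …, ⌈n/2⌉, ⌈n/2⌉, …, 3, 2` up to order (for `n ≥ 3`): each of
`2, …, n-1` once, with `n-1` and `⌈n/2⌉` occurring once more. -/
def minDegreeSequence (n : ℕ) : Multiset ℕ :=
  Multiset.Icc 2 (n - 1) + {n - 1, (n + 1) / 2}

/-- The graph `G_n` on the vertices `0, …, n-1`. Numbered from `1`, distinct vertices are adjacent
when the sum of their numbers is at least `n`. -/
def minGraph (n : ℕ) : SimpleGraph (Fin n) where
  Adj i j := i ≠ j ∧ n ≤ (i.val + 1) + (j.val + 1)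
  symm := ⟨fun _ _ h => ⟨h.1.symm, by have := h.2; omega⟩⟩
  loopless := ⟨fun _ h => h.1 rfl⟩

/-!
Hamilton cycles are counted through the cyclic permutations of the vertices that move every vertex
along an edge; from three vertices on, each Hamilton cycle gives two of them, one for each direction
(`ncard_cyclicPerms_univ`).

The count for `minGraph n`. Number the vertices from `1`. Vertex `1` has only the neighbours `n - 1`
and `n`, so every Hamilton cycle runs through `n - 1, 1, n`. Deleting `1` and `n` leaves a copy of
`minGraph (n - 2)`, and since `n - 1` dominates it, contracting the path to `n - 1` leaves a cycle
there. Conversely a directed cycle on the copy arises from exactly two directed cycles, because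
`1, n` can be inserted just after `n - 1` or `n, 1` just before it (`ncard_cyclicPerms_insert`). So
the count doubles when `n` grows by two, starting from one cyclic permutation for `n = 1` and for
`n = 2`.

The lower bound. Sort the vertices of a hamiltonian threshold graph by weight. If vertex `i` were
not adjacent to vertex `n - i`, where `2 * i < n`, the first `i` vertices would have all their
neighbours among the last `i`, and a Hamilton cycle could never leave these `2 * i < n` vertices
(`adj_of_isCyclicOn`). Hence the graph contains `minGraph n` on the same vertices. If it contains
another edge, it also contains one that joins some `i` to `n - 1 - i`, and through this edge there
is a Hamilton cycle (`exists_cyclicPerm_apply_eq`), which makes the count strictly larger.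

The degree sequence determines `minGraph n` among all graphs: match the vertices so that degrees
agree, and then, working inwards from both ends of the order, the degrees force the neighbourhoods
(`eq_minGraph_of_degree_eq`).
-/

open Equiv

/-! ### Cyclic permutations -/

/-- The permutation `σ` moves points of `s` only and permutes `s` cyclically: it fixes every point
outside `s`, and no proper nonempty subset of `s` is mapped into itself. For a finite `s` the second
condition says that `s` is a single orbit. A one-point set is permuted cyclically by the identity,
which lets recursions start at one vertex. -/
def IsCyclicOn {V : Type*} (σ : Perm V) (s : Set V) : Prop :=
  (∀ v, v ∉ s → σ v = v) ∧
    ∀ A : Set V, A ⊆ s → A.Nonempty → (∀ v ∈ A, σ v ∈ A) → A = s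

/-- The cyclic permutations of `s` that move every vertex along an edge of `G`. When `s` has at
least three elements these are the Hamilton cycles of the subgraph induced on `s`, each with one of
its two directions; for two adjacent vertices and for one vertex there is one such permutation. -/
def cyclicPerms {V : Type*} (G : SimpleGraph V) (s : Set V) : Set (Perm V) :=
  {σ | IsCyclicOn σ s ∧ ∀ v, σ v ≠ v → G.Adj v (σ v)}

section CyclicPermutations

variable {V : Type*} {σ τ : Perm V} {s : Set V}

theorem IsCyclicOn.apply_mem (h : IsCyclicOn σ s) {v : V} (hv : v ∈ s) : σ v ∈ s := by
  by_contra hn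
  have h1 : σ v = v := σ.injective (h.1 _ hn)
  exact hn (h1.symm ▸ hv)

theorem IsCyclicOn.inv [Finite V] (h : IsCyclicOn σ s) : IsCyclicOn σ⁻¹ s := by
  refine ⟨fun v hv => Perm.inv_eq_iff_eq.2 (h.1 v hv).symm, fun A hA hne hinv => h.2 A hA hne ?_⟩
  intro v hv
  exact Perm.perm_symm_mapsTo_of_mapsTo σ⁻¹ (s := A) hinv hv

theorem isCyclicOn_univ_iff [Finite V] :
    IsCyclicOn σ Set.univ ↔ ∀ x y, σ.SameCycle x y := by
  constructor
  · intro h x y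
    have := h.2 {y | σ.SameCycle x y} (Set.subset_univ _) ⟨x, Perm.SameCycle.refl _ _⟩
      (fun v hv => Perm.sameCycle_apply_right.2 hv)
    exact Set.eq_univ_iff_forall.1 this y
  · refine fun h => ⟨fun v hv => absurd (Set.mem_univ v) hv, fun A _ ⟨x, hx⟩ hinv => ?_⟩
    refine Set.eq_univ_of_forall fun y => ?_
    obtain ⟨k, -, rfl⟩ := (h x y).exists_pow_eq'
    exact Set.MapsTo.perm_pow (f := σ) (s := A) hinv k hx

theorem IsCyclicOn.isCycleOn [Fintype V] (h : IsCyclicOn σ Set.univ) :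
    σ.IsCycleOn (Finset.univ : Finset V) := by
  refine ⟨by simp, fun x _ y _ => isCyclicOn_univ_iff.1 h x y⟩

/-- A cyclic permutation of at least three points has no orbit of length at most two. -/
theorem IsCyclicOn.apply_apply_ne [Fintype V] (h : IsCyclicOn σ Set.univ)
    (hV : 3 ≤ Fintype.card V) (v : V) : σ (σ v) ≠ v := by
  intro hv
  have := (h.isCycleOn.pow_apply_eq (Finset.mem_univ v) (n := 2)).1 (by simpa [pow_two] using hv)
  have := Nat.le_of_dvd (by norm_num) this
  rw [Finset.card_univ] at this
  omega

theorem IsCyclicOn.apply_ne [Fintype V] (h : IsCyclicOn σ Set.univ)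
    (hV : 3 ≤ Fintype.card V) (v : V) : σ v ≠ v := by
  intro hv
  exact h.apply_apply_ne hV v (by rw [hv, hv])

variable [DecidableEq V] {p x : V}

/-- If `x` is fixed by `σ`, then `σ * swap p x` inserts `x` into the cycle through `p`, directly
after `p`. -/
theorem IsCyclicOn.mul_swap (h : IsCyclicOn σ s) (hp : p ∈ s) (hx : x ∉ s) :
    IsCyclicOn (σ * swap p x) (insert x s) := by
  have hpx : p ≠ x := fun e => hx (e ▸ hp)
  have e1 : (σ * swap p x) p = x := by simp [h.1 x hx]
  have e2 : (σ * swap p x) x = σ p := by simp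
  have e3 : ∀ v, v ≠ p → v ≠ x → (σ * swap p x) v = σ v := fun v h1 h2 => by
    simp [swap_apply_of_ne_of_ne h1 h2]
  refine ⟨fun v hv => ?_, fun A hA hne hinv => ?_⟩
  · rw [Set.mem_insert_iff, not_or] at hv
    rw [e3 v (fun e => hv.2 (e ▸ hp)) hv.1, h.1 v hv.2]
  · have hs : A ∩ s = s := by
      refine h.2 _ Set.inter_subset_right ?_ ?_
      · obtain ⟨v, hv⟩ := hne
        rcases hA hv with rfl | hvs
        · exact ⟨σ p, e2 ▸ hinv _ hv, h.apply_mem hp⟩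
        · exact ⟨v, hv, hvs⟩
      · rintro v ⟨hv, hvs⟩
        refine ⟨?_, h.apply_mem hvs⟩
        by_cases hvp : v = p
        · subst hvp
          exact e2 ▸ hinv _ (e1 ▸ hinv _ hv)
        · exact e3 v hvp (fun e => hx (e ▸ hvs)) ▸ hinv _ hv
    have hs' : s ⊆ A := fun v hv => (hs.symm ▸ hv : v ∈ A ∩ s).1
    exact hA.antisymm (Set.insert_subset (e1 ▸ hinv _ (hs' hp)) hs')

/-- Removing from a cyclic permutation the point `x` that follows `p` leaves a cyclic
permutation. -/
theorem IsCyclicOn.of_insert (h : IsCyclicOn σ (insert x s)) (hp : p ∈ s) (hx : x ∉ s)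
    (hpx : σ p = x) : IsCyclicOn (σ * swap p x) s := by
  have e1 : (σ * swap p x) p = σ x := by simp
  have e2 : (σ * swap p x) x = x := by simp [hpx]
  have e3 : ∀ v, v ≠ p → v ≠ x → (σ * swap p x) v = σ v := fun v h1 h2 => by
    simp [swap_apply_of_ne_of_ne h1 h2]
  refine ⟨fun v hv => ?_, fun A hA hne hinv => ?_⟩
  · by_cases hvx : v = x
    · rw [hvx, e2]
    · rw [e3 v (fun e => hv (e ▸ hp)) hvx, h.1 v (by simp [hvx, hv])]
  · have hxA : x ∉ A := fun e => hx (hA e)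
    by_cases hpA : p ∈ A
    · have := h.2 (insert x A) (Set.insert_subset_insert hA) ⟨x, by simp⟩ ?_
      · refine hA.antisymm fun v hv => ?_
        have h1 : v ∈ insert x A := this.symm ▸ Set.mem_insert_of_mem _ hv
        exact h1.resolve_left fun e => hx (e ▸ hv)
      · rintro v (rfl | hv)
        · exact Set.mem_insert_of_mem _ (e1 ▸ hinv _ hpA)
        · by_cases hvp : v = p
          · rw [hvp, hpx]; exact Set.mem_insert _ _
          · exact Set.mem_insert_of_mem _ (e3 v hvp (fun e => hxA (e ▸ hv)) ▸ hinv _ hv)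
    · have := h.2 A (hA.trans (Set.subset_insert _ _)) hne ?_
      · exact absurd (this.symm ▸ Set.mem_insert x s) hxA
      · intro v hv
        exact e3 v (fun e => hpA (e ▸ hv)) (fun e => hxA (e ▸ hv)) ▸ hinv _ hv

end CyclicPermutations

/-! ### Insertion of two vertices into a cycle -/

section Insertion

variable {V : Type*} {G : SimpleGraph V} {σ τ : Perm V} {s : Set V}

theorem cyclicPerms_mono {G' : SimpleGraph V} (h : G ≤ G') (s : Set V) :
    cyclicPerms G s ⊆ cyclicPerms G' s :=
  fun _ hσ => ⟨hσ.1, fun v hv => h (hσ.2 v hv)⟩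

theorem inv_mem_cyclicPerms [Finite V] (h : σ ∈ cyclicPerms G s) : σ⁻¹ ∈ cyclicPerms G s := by
  refine ⟨h.1.inv, fun v hv => ?_⟩
  have hs : σ (σ⁻¹ v) = v := by simp
  have := h.2 (σ⁻¹ v) (by rw [hs]; exact hv.symm)
  rw [hs] at this
  exact this.symm

variable [DecidableEq V] {p a b : V}

/-- The permutation `σ * swap p a * swap a b` follows `σ`, with `p ↦ σ p` replaced by
`p ↦ a ↦ b ↦ σ p`. -/
theorem insert_apply (hpa : p ≠ a) (hpb : p ≠ b) (hab : a ≠ b) (ha : σ a = a) (hb : σ b = b) :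
    (σ * swap p a * swap a b) p = a ∧ (σ * swap p a * swap a b) a = b ∧
      (σ * swap p a * swap a b) b = σ p ∧
      ∀ v, v ≠ p → v ≠ a → v ≠ b → (σ * swap p a * swap a b) v = σ v := by
  refine ⟨?_, ?_, ?_, fun v h1 h2 h3 => ?_⟩
  · simp [swap_apply_of_ne_of_ne hpa hpb, ha]
  · simp [swap_apply_of_ne_of_ne hpb.symm hab.symm, hb]
  · simp
  · simp [swap_apply_of_ne_of_ne h2 h3, swap_apply_of_ne_of_ne h1 h2]

theorem insert_mem_cyclicPerms (h : σ ∈ cyclicPerms G s) (hp : p ∈ s) (ha : a ∉ s) (hb : b ∉ s)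
    (hpa : G.Adj p a) (hab : G.Adj a b) (hbs : ∀ v ∈ s, G.Adj b v) :
    σ * swap p a * swap a b ∈ cyclicPerms G (insert b (insert a s)) := by
  have hpb : p ≠ b := fun e => hb (e ▸ hp)
  obtain ⟨e1, e2, e3, e4⟩ := insert_apply hpa.ne hpb hab.ne (h.1.1 a ha) (h.1.1 b hb)
  refine ⟨(h.1.mul_swap hp ha).mul_swap (Set.mem_insert _ _) (by simp [hab.ne', hb]),
    fun v hv => ?_⟩
  by_cases h1 : v = p
  · subst h1; rwa [e1]
  by_cases h2 : v = a
  · subst h2; rwa [e2]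
  by_cases h3 : v = b
  · subst h3; rw [e3]; exact hbs _ (h.1.apply_mem hp)
  rw [e4 v h1 h2 h3] at hv ⊢
  exact h.2 v hv

/-- Contracting `p ↦ a ↦ b ↦ y` to `p ↦ y` undoes the insertion of `a` and `b`. -/
theorem exists_insert_eq (h : τ ∈ cyclicPerms G (insert b (insert a s)))
    (hp : p ∈ s) (ha : a ∉ s) (hb : b ∉ s) (hab : a ≠ b) (hps : ∀ v ∈ s, v ≠ p → G.Adj p v)
    (hpa : τ p = a) (hτ : τ a = b) :
    ∃ σ ∈ cyclicPerms G s, σ * swap p a * swap a b = τ := by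
  have hpa' : p ≠ a := fun e => ha (e ▸ hp)
  have hpb : p ≠ b := fun e => hb (e ▸ hp)
  have hca : (τ * swap a b) p = a := by simp [swap_apply_of_ne_of_ne hpa' hpb, hpa]
  have hc := (h.1.of_insert (Set.mem_insert a s) (by simp [hab.symm, hb]) hτ).of_insert hp ha hca
  refine ⟨τ * swap a b * swap p a, ⟨hc, fun v hv => ?_⟩, by simp [mul_assoc]⟩
  have hvs : v ∈ s := by
    by_contra hn
    exact hv (hc.1 v hn)
  by_cases hvp : v = p
  · subst hvp
    exact hps _ (hc.apply_mem hvs) hv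
  · have hva : v ≠ a := fun e => ha (e ▸ hvs)
    have hvb : v ≠ b := fun e => hb (e ▸ hvs)
    have e : (τ * swap a b * swap p a) v = τ v := by
      simp [swap_apply_of_ne_of_ne hvp hva, swap_apply_of_ne_of_ne hva hvb]
    rw [e] at hv ⊢
    exact h.2 v hv

/-- If `a` has only the neighbours `p` and `b` and both `p` and `b` are adjacent to all of `s`,
every cycle through `insert b (insert a s)` runs through `p, a, b` or through `b, a, p`. Contracting
this path to `p` leaves a cycle through `s`, and both directions arise from each such cycle. -/
theorem ncard_cyclicPerms_insert [Finite V] (hp : p ∈ s) (ha : a ∉ s) (hb : b ∉ s)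
    (hpa : G.Adj p a) (hab : G.Adj a b) (hbs : ∀ v ∈ s, G.Adj b v)
    (hps : ∀ v ∈ s, v ≠ p → G.Adj p v) (has : ∀ v ∈ s, G.Adj a v → v = p) :
    (cyclicPerms G (insert b (insert a s))).ncard = 2 * (cyclicPerms G s).ncard := by
  have hpb : p ≠ b := fun e => hb (e ▸ hp)
  set F : Perm V → Perm V := fun σ => σ * swap p a * swap a b with hF
  have hFi : Function.Injective F := fun σ τ h => by simpa [hF] using h
  have hunion : cyclicPerms G (insert b (insert a s)) =
      F '' cyclicPerms G s ∪ Inv.inv '' (F '' cyclicPerms G s) := by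
    ext τ
    constructor
    · intro h
      -- `a` is not fixed, and its two neighbours along `τ` differ, so they are `p` and `b`
      have nbr : ∀ ρ ∈ cyclicPerms G (insert b (insert a s)), ρ a = b ∨ ρ a = p := by
        intro ρ hρ
        have hne : ρ a ≠ a := by
          intro e
          have := hρ.1.2 {a} (by simp) (by simp) (by simp [e])
          have : b ∈ ({a} : Set V) := this.symm ▸ Set.mem_insert _ _
          exact hab.ne' this
        have hadj := hρ.2 a hne
        rcases hρ.1.apply_mem (Set.mem_insert_of_mem b (Set.mem_insert a s)) with h1 | h1 | h1
        · exact Or.inl h1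
        · exact absurd h1 hne
        · exact Or.inr (has _ h1 hadj)
      have two : ∀ ρ ∈ cyclicPerms G (insert b (insert a s)), ρ (ρ a) ≠ a := by
        intro ρ hρ e
        have h2 := hρ.1.2 {a, ρ a}
          (by
            have := hρ.1.apply_mem (Set.mem_insert_of_mem b (Set.mem_insert a s))
            rintro v (rfl | rfl)
            · simp
            · exact this)
          (by simp) (by rintro v (rfl | rfl) <;> simp [e])
        have h3 : b ∈ ({a, ρ a} : Set V) := h2.symm ▸ Set.mem_insert _ _
        have h4 : p ∈ ({a, ρ a} : Set V) := h2.symm ▸ by simp [hp]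
        rcases h3 with h3 | h3
        · exact hab.ne' h3
        · rcases h4 with h4 | h4
          · exact hpa.ne h4
          · exact hpb (h4.trans h3.symm)
      -- a cycle with `a ↦ b` has `p ↦ a`, and so arises by insertion
      have key : ∀ ρ ∈ cyclicPerms G (insert b (insert a s)), ρ a = b →
          ρ ∈ F '' cyclicPerms G s := by
        intro ρ hρ hρb
        have h1 : ρ⁻¹ a = p := by
          refine (nbr _ (inv_mem_cyclicPerms hρ)).resolve_left fun e => two ρ hρ ?_
          simp [hρb, ← e]
        obtain ⟨σ, hσ, he⟩ := exists_insert_eq hρ hp ha hb hab.ne hps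
          (Perm.inv_eq_iff_eq.1 h1).symm hρb
        exact ⟨σ, hσ, he⟩
      rcases nbr τ h with h1 | h1
      · exact Or.inl (key τ h h1)
      · refine Or.inr ⟨τ⁻¹, key _ (inv_mem_cyclicPerms h) ?_, inv_inv τ⟩
        refine (nbr _ (inv_mem_cyclicPerms h)).resolve_right fun e => two τ h ?_
        simp [h1, ← e]
    · rintro (⟨σ, hσ, rfl⟩ | ⟨_, ⟨σ, hσ, rfl⟩, rfl⟩)
      · exact insert_mem_cyclicPerms hσ hp ha hb hpa hab hbs
      · exact inv_mem_cyclicPerms (insert_mem_cyclicPerms hσ hp ha hb hpa hab hbs)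
  rw [hunion, Set.ncard_union_eq, Set.ncard_image_of_injective _ inv_injective,
    Set.ncard_image_of_injective _ hFi, two_mul]
  rw [Set.disjoint_left]
  rintro _ ⟨σ, hσ, rfl⟩ ⟨_, ⟨ρ, hρ, rfl⟩, h⟩
  have e1 := (insert_apply hpa.ne hpb hab.ne (hσ.1.1 a ha) (hσ.1.1 b hb)).2.1
  have e2 := (insert_apply hpa.ne hpb hab.ne (hρ.1.1 a ha) (hρ.1.1 b hb)).1
  have h3 : (F ρ)⁻¹ a = b := by rw [h]; exact e1
  have h4 : a = F ρ b := Perm.inv_eq_iff_eq.1 h3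
  exact hpb ((F ρ).injective (e2.trans h4))

end Insertion

/-! ### Hamilton cycles as cyclic permutations -/

section HamiltonCycles

variable {V : Type*} {G : SimpleGraph V} {σ τ : Perm V}

/-- The edges run through by a permutation. -/
def permEdges (σ : Perm V) : Set (Sym2 V) := Set.range fun v => s(v, σ v)

theorem permEdges_inv (σ : Perm V) : permEdges σ⁻¹ = permEdges σ := by
  ext e
  constructor
  · rintro ⟨v, rfl⟩
    exact ⟨σ⁻¹ v, by simp [Sym2.eq_swap]⟩
  · rintro ⟨v, rfl⟩
    exact ⟨σ v, by simp [Sym2.eq_swap]⟩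

theorem apply_eq_or_of_permEdges_eq (h : permEdges σ = permEdges τ) (v : V) :
    σ v = τ v ∨ σ v = τ⁻¹ v := by
  have : s(v, σ v) ∈ permEdges τ := h ▸ ⟨v, rfl⟩
  obtain ⟨w, hw⟩ := this
  rcases Sym2.eq_iff.1 hw with ⟨rfl, h2⟩ | ⟨rfl, h2⟩
  · exact Or.inl h2.symm
  · exact Or.inr (Perm.eq_inv_iff_eq.2 h2)

/-- Two cyclic permutations with the same edges that agree at one point agree everywhere: there is
only one way to go on along the cycle. -/
theorem eq_of_permEdges_eq_of_apply_eq [Fintype V] (hσ : IsCyclicOn σ Set.univ)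
    (hτ : IsCyclicOn τ Set.univ) (hV : 3 ≤ Fintype.card V) (h : permEdges σ = permEdges τ) {v : V}
    (hv : σ v = τ v) : σ = τ := by
  have := hτ.2 {w | σ w = τ w} (Set.subset_univ _) ⟨v, hv⟩ fun w (hw : σ w = τ w) => by
    refine (apply_eq_or_of_permEdges_eq h (τ w)).resolve_right fun e => ?_
    exact hσ.apply_apply_ne hV w (by rw [hw, e]; simp)
  exact Equiv.ext fun w => Set.eq_univ_iff_forall.1 this w

theorem permEdges_eq_iff [Fintype V] (hσ : IsCyclicOn σ Set.univ)
    (hτ : IsCyclicOn τ Set.univ) (hV : 3 ≤ Fintype.card V) :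
    permEdges σ = permEdges τ ↔ σ = τ ∨ σ = τ⁻¹ := by
  constructor
  · intro h
    have hne : Nonempty V := Fintype.card_pos_iff.1 (by omega)
    obtain ⟨v⟩ := hne
    rcases apply_eq_or_of_permEdges_eq h v with h1 | h1
    · exact Or.inl (eq_of_permEdges_eq_of_apply_eq hσ hτ hV h h1)
    · exact Or.inr (eq_of_permEdges_eq_of_apply_eq hσ hτ.inv hV
        (h.trans (permEdges_inv τ).symm) h1)
  · rintro (rfl | rfl)
    · rfl
    · exact permEdges_inv τ

/-- A Hamilton cycle, run through in the direction of the walk, is a cyclic permutation. -/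
theorem exists_perm_of_isHamiltonianCycle [Fintype V] [DecidableEq V] {a : V} {p : G.Walk a a}
    (hp : p.IsHamiltonianCycle) :
    ∃ σ ∈ cyclicPerms G Set.univ, permEdges σ = p.edgeSet := by
  set l := p.support.tail with hl
  have hlen : l.length = p.length := by simp [hl]
  have h3 : 3 ≤ p.length := hp.isCycle.three_le_length
  have hn : l.Nodup := hp.isCycle.support_nodup
  have hmem : ∀ v, v ∈ l := fun v => by
    have := (SimpleGraph.Walk.isHamiltonianCycle_iff_isCycle_and_support_count_tail_eq_one.1 hp).2 v
    exact List.count_pos_iff.1 (by rw [hl, this]; norm_num)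
  have hget : ∀ i (hi : i < l.length), l[i] = p.getVert (i + 1) := fun i hi => by
    simp only [hl, List.getElem_tail]
    rw [SimpleGraph.Walk.support_getElem_eq_getVert]
  -- the cyclic shift of the vertices in the order of the walk
  have happ : ∀ i < p.length, l.formPerm (p.getVert i) = p.getVert (i + 1) := fun i hi => by
    rcases Nat.eq_zero_or_pos i with rfl | hi0
    · have h0 : p.getVert 0 = l[p.length - 1] := by
        rw [hget, Nat.sub_add_cancel (by omega)]; simp
      rw [h0, List.formPerm_apply_getElem _ hn, hget]
      simp [hlen, Nat.sub_add_cancel (by omega : 1 ≤ p.length)]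
    · have h0 : p.getVert i = l[i - 1] := by
        rw [hget, Nat.sub_add_cancel hi0]
      rw [h0, List.formPerm_apply_getElem _ hn, hget]
      simp [hlen, Nat.sub_add_cancel hi0, Nat.mod_eq_of_lt hi]
  have hidx : ∀ v, ∃ i < p.length, p.getVert i = v := fun v => by
    obtain ⟨i, hi, rfl⟩ := List.getElem_of_mem (hmem v)
    rw [hget]
    rcases Nat.lt_or_ge (i + 1) p.length with h | h
    · exact ⟨i + 1, h, rfl⟩
    · refine ⟨0, by omega, ?_⟩
      rw [show i + 1 = p.length by omega]
      simp
  have hadj : ∀ v, G.Adj v (l.formPerm v) := fun v => by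
    obtain ⟨i, hi, rfl⟩ := hidx v
    rw [happ i hi]
    exact p.adj_getVert_succ hi
  have hc := List.isCycle_formPerm hn (by omega : 2 ≤ l.length)
  refine ⟨l.formPerm, ⟨isCyclicOn_univ_iff.2 fun x y => hc.sameCycle (hadj x).ne' (hadj y).ne',
    fun v _ => hadj v⟩, ?_⟩
  ext e
  induction e with | _ u v
  rw [SimpleGraph.Walk.mem_edgeSet, SimpleGraph.Walk.mk_mem_edges_iff_exists]
  constructor
  · rintro ⟨w, hw⟩
    obtain ⟨i, hi, rfl⟩ := hidx w
    exact ⟨i, hi, by rw [← happ i hi]; exact hw⟩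
  · rintro ⟨i, hi, h⟩
    exact ⟨p.getVert i, by rw [← h, ← happ i hi]⟩

theorem exists_walk_of_perm (h : ∀ v, G.Adj v (σ v)) (v : V) (k : ℕ) :
    ∃ w : G.Walk v ((σ ^ k) v), w.length = k ∧ ∀ i ≤ k, w.getVert i = (σ ^ i) v := by
  induction k generalizing v with
  | zero =>
    refine ⟨.nil, rfl, fun i hi => ?_⟩
    obtain rfl := Nat.le_zero.1 hi
    rfl
  | succ k ih =>
    obtain ⟨w, hw, hget⟩ := ih (σ v)
    have e : ∀ i, (σ ^ i) (σ v) = (σ ^ (i + 1)) v := fun i => by rw [pow_succ]; rfl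
    refine ⟨(SimpleGraph.Walk.cons (h v) w).copy rfl (e k), by simp [hw], fun i hi => ?_⟩
    rw [SimpleGraph.Walk.getVert_copy]
    cases i with
    | zero => simp
    | succ i => rw [SimpleGraph.Walk.getVert_cons_succ, hget i (by omega), e]

/-- Following a cyclic permutation from any vertex runs through a Hamilton cycle. -/
theorem exists_isHamiltonianCycle_of_perm [Fintype V] [DecidableEq V]
    (hV : 3 ≤ Fintype.card V) (hσ : σ ∈ cyclicPerms G Set.univ) :
    ∃ (a : V) (p : G.Walk a a), p.IsHamiltonianCycle ∧ p.edgeSet = permEdges σ := by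
  have hadj : ∀ v, G.Adj v (σ v) := fun v => hσ.2 v (hσ.1.apply_ne hV v)
  have hne : Nonempty V := Fintype.card_pos_iff.1 (by omega)
  obtain ⟨v⟩ := hne
  set n := Fintype.card V with hn
  have e : ∀ i, (σ ^ i) (σ v) = (σ ^ (i + 1)) v := fun i => by rw [pow_succ]; rfl
  have hpow : (σ ^ n) v = v := by
    have := hσ.1.isCycleOn.pow_card_apply (Finset.mem_univ v)
    rwa [Finset.card_univ] at this
  have hinj : ∀ i < n, ∀ j < n, (σ ^ i) v = (σ ^ j) v → i = j := fun i hi j hj h => by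
    have := (hσ.1.isCycleOn.pow_apply_eq_pow_apply (Finset.mem_univ v)).1 h
    rw [Finset.card_univ] at this
    exact Nat.ModEq.eq_of_lt_of_lt this hi hj
  obtain ⟨w, hw, hget⟩ := exists_walk_of_perm hadj (σ v) (n - 1)
  have hget' : ∀ i < n, w.getVert i = (σ ^ (i + 1)) v := fun i hi => by
    rw [hget i (by omega), e]
  have hend : (σ ^ (n - 1)) (σ v) = v := by
    rw [e, Nat.sub_add_cancel (by omega), hpow]
  have hpath : w.IsPath := by
    rw [← SimpleGraph.Walk.IsPath.getVert_injOn_iff]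
    intro i hi j hj h
    simp only [Set.mem_ofPred_eq, hw] at hi hj
    rw [hget i hi, hget j hj, e, e, pow_succ', pow_succ', Perm.mul_apply, Perm.mul_apply] at h
    exact hinj i (by omega) j (by omega) (σ.injective h)
  have hlast : s(v, σ v) ∉ w.edges := by
    rw [SimpleGraph.Walk.mk_mem_edges_iff_exists]
    rintro ⟨i, hi, h⟩
    rw [hget' i (by omega), hget' (i + 1) (by omega)] at h
    rcases Sym2.eq_iff.1 h with ⟨h1, -⟩ | ⟨h1, h2⟩
    · have := hinj (i + 1) (by omega) 0 (by omega) (by simpa using h1)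
      omega
    · have := hinj (i + 1) (by omega) 1 (by omega) (by simpa using h1)
      have h0 : i = 0 := by omega
      subst h0
      exact hσ.1.apply_apply_ne hV v (by simpa [pow_two] using h2)
  refine ⟨v, .cons (hadj v) (w.copy rfl hend), ?_, ?_⟩
  · rw [SimpleGraph.Walk.isHamiltonianCycle_iff_isCycle_and_length_eq,
      SimpleGraph.Walk.cons_isCycle_iff]
    refine ⟨⟨by simpa using hpath, by simpa using hlast⟩, ?_⟩
    simp [hw]
    omega
  · ext f
    induction f with | _ x y
    rw [SimpleGraph.Walk.mem_edgeSet, SimpleGraph.Walk.edges_cons, List.mem_cons,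
      SimpleGraph.Walk.edges_copy, SimpleGraph.Walk.mk_mem_edges_iff_exists]
    constructor
    · rintro (h | ⟨i, hi, h⟩)
      · exact ⟨v, h.symm⟩
      · refine ⟨(σ ^ (i + 1)) v, ?_⟩
        rw [← h, hget' i (by omega), hget' (i + 1) (by omega), pow_succ' σ (i + 1)]
        rfl
    · rintro ⟨u, hu⟩
      obtain ⟨k, hk, rfl⟩ :=
        hσ.1.isCycleOn.exists_pow_eq (Finset.mem_univ v) (Finset.mem_univ u)
      rw [Finset.card_univ] at hk
      cases k with
      | zero => exact Or.inl hu.symm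
      | succ i =>
        refine Or.inr ⟨i, by omega, ?_⟩
        rw [hget' i (by omega), hget' (i + 1) hk, ← hu, pow_succ' σ (i + 1)]
        rfl

theorem hamiltonCycles_eq_image [Fintype V] (hV : 3 ≤ Fintype.card V) :
    hamiltonCycles G = permEdges '' cyclicPerms G Set.univ := by
  classical
  ext C
  constructor
  · rintro ⟨a, p, hp, rfl⟩
    exact exists_perm_of_isHamiltonianCycle (by convert hp)
  · rintro ⟨σ, hσ, rfl⟩
    obtain ⟨a, p, hp, h⟩ := exists_isHamiltonianCycle_of_perm hV hσ
    exact ⟨a, p, by convert hp, h⟩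

theorem isHamiltonian_iff_nonempty_cyclicPerms [Fintype V] [DecidableEq V]
    (hV : 3 ≤ Fintype.card V) : G.IsHamiltonian ↔ (cyclicPerms G Set.univ).Nonempty := by
  constructor
  · intro h
    obtain ⟨a, p, hp⟩ := h (by omega)
    obtain ⟨σ, hσ, -⟩ := exists_perm_of_isHamiltonianCycle hp
    exact ⟨σ, hσ⟩
  · rintro ⟨σ, hσ⟩ -
    obtain ⟨a, p, hp, -⟩ := exists_isHamiltonianCycle_of_perm hV hσ
    exact ⟨a, p, hp⟩

/-- Each Hamilton cycle is counted twice by cyclic permutations, once for each direction. -/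
theorem ncard_cyclicPerms_univ [Fintype V] (hV : 3 ≤ Fintype.card V) :
    (cyclicPerms G Set.univ).ncard = 2 * numHamiltonCycles G := by
  classical
  have hfin : (cyclicPerms G Set.univ).Finite := Set.toFinite _
  rw [numHamiltonCycles, hamiltonCycles_eq_image hV, ← hfin.coe_toFinset, Set.ncard_coe_finset,
    ← Finset.coe_image, Set.ncard_coe_finset, Finset.card_eq_sum_card_image permEdges,
    Finset.sum_const_nat (m := 2), mul_comm]
  intro C hC
  obtain ⟨σ, hσ, rfl⟩ := Finset.mem_image.1 hC
  rw [Set.Finite.mem_toFinset] at hσ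
  have hne : Nonempty V := Fintype.card_pos_iff.1 (by omega)
  obtain ⟨v⟩ := hne
  rw [Finset.card_eq_two]
  refine ⟨σ, σ⁻¹, fun h => hσ.1.apply_apply_ne hV v ?_, ?_⟩
  · nth_rewrite 1 [h]
    simp
  · ext τ
    simp only [Finset.mem_filter, Set.Finite.mem_toFinset, Finset.mem_insert,
      Finset.mem_singleton]
    constructor
    · rintro ⟨hτ, h⟩
      exact (permEdges_eq_iff hτ.1 hσ.1 hV).1 h
    · rintro (rfl | rfl)
      · exact ⟨hσ, rfl⟩
      · exact ⟨inv_mem_cyclicPerms hσ, permEdges_inv _⟩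

theorem IsCyclicOn.conj {W : Type*} (e : V ≃ W) (h : IsCyclicOn σ Set.univ) :
    IsCyclicOn (e.permCongr σ) Set.univ := by
  refine ⟨fun v hv => absurd (Set.mem_univ v) hv, fun A _ ⟨x, hx⟩ hinv => ?_⟩
  have := h.2 (e ⁻¹' A) (Set.subset_univ _) ⟨e.symm x, by simpa using hx⟩
    (fun v hv => by simpa using hinv (e v) hv)
  exact Set.eq_univ_of_forall fun y => by simpa using Set.eq_univ_iff_forall.1 this (e.symm y)

theorem ncard_cyclicPerms_le_of_iso {W : Type*} [Finite W] {H : SimpleGraph W} (e : G ≃g H) :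
    (cyclicPerms G Set.univ).ncard ≤ (cyclicPerms H Set.univ).ncard := by
  refine Set.ncard_le_ncard_of_injOn (e.toEquiv.permCongr) ?_
    (e.toEquiv.permCongr.injective.injOn) (Set.toFinite _)
  rintro σ ⟨h1, h2⟩
  refine ⟨h1.conj _, fun w hw => ?_⟩
  have := h2 (e.toEquiv.symm w) fun hc => hw (by simp [permCongr_apply, hc])
  rw [← e.map_adj_iff] at this
  have he : e (e.toEquiv.symm w) = w := e.toEquiv.apply_symm_apply w
  rw [he] at this
  exact this

theorem numHamiltonCycles_congr [Fintype V] {W : Type*} {H : SimpleGraph W}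
    (hV : 3 ≤ Fintype.card V) (e : G ≃g H) : numHamiltonCycles G = numHamiltonCycles H := by
  have : Fintype W := Fintype.ofEquiv V e.toEquiv
  have hW : 3 ≤ Fintype.card W := (Fintype.card_congr e.toEquiv) ▸ hV
  have h1 := ncard_cyclicPerms_le_of_iso e
  have h2 := ncard_cyclicPerms_le_of_iso e.symm
  rw [ncard_cyclicPerms_univ hV, ncard_cyclicPerms_univ hW] at h1 h2
  omega

end HamiltonCycles

/-! ### Cycles on one and on two vertices -/

section SmallSets

variable {V : Type*} {G : SimpleGraph V} {σ : Perm V}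

theorem isCyclicOn_one_singleton (x : V) : IsCyclicOn (1 : Perm V) {x} := by
  refine ⟨fun v _ => rfl, fun A hA hne _ => ?_⟩
  exact (Set.subset_singleton_iff_eq.1 hA).resolve_left hne.ne_empty

theorem cyclicPerms_singleton (x : V) : cyclicPerms G {x} = {1} := by
  ext σ
  constructor
  · intro h
    refine Equiv.ext fun v => ?_
    by_cases hv : v = x
    · subst hv
      exact h.1.apply_mem rfl
    · exact h.1.1 v hv
  · rintro rfl
    exact ⟨isCyclicOn_one_singleton x, fun v hv => absurd rfl hv⟩

theorem cyclicPerms_pair [DecidableEq V] {x y : V} (h : G.Adj x y) :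
    cyclicPerms G {x, y} = {swap x y} := by
  ext σ
  constructor
  · intro hσ
    have hx : σ x ≠ x := fun e => by
      have := hσ.1.2 {x} (by simp) (by simp) (by simp [e])
      exact h.ne' (show y ∈ ({x} : Set V) from this.symm ▸ by simp)
    have hx' : σ x = y := (hσ.1.apply_mem (Set.mem_insert _ _)).resolve_left hx
    have hy : σ y = x := (hσ.1.apply_mem (Set.mem_insert_of_mem x rfl)).resolve_right
      fun e => h.ne (σ.injective (hx'.trans (Set.mem_singleton_iff.1 e).symm))
    refine Equiv.ext fun v => ?_
    by_cases h1 : v = x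
    · simp [h1, hx']
    by_cases h2 : v = y
    · simp [h2, hy]
    rw [swap_apply_of_ne_of_ne h1 h2, hσ.1.1 v (by simp [h1, h2])]
  · rintro rfl
    constructor
    · have := (isCyclicOn_one_singleton x).mul_swap (p := x) rfl (x := y) (by simp [h.ne'])
      rwa [one_mul, Set.pair_comm] at this
    · intro v hv
      rcases (swap_apply_ne_self_iff.1 hv).2 with rfl | rfl
      · simpa using h
      · simpa using h.symm

end SmallSets

/-! ### The Hamilton cycles of the minimal graph -/

section MinGraph

variable {n : ℕ}

/-- The vertices of `minGraph n` that remain after the first and the last `k` are deleted. They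
induce a copy of `minGraph (n - 2 * k)`. -/
def middleLayer (n k : ℕ) : Set (Fin n) := {i | k ≤ i.val ∧ i.val + k < n}

theorem middleLayer_zero (n : ℕ) : middleLayer n 0 = Set.univ := by
  ext i
  simp [middleLayer]

theorem middleLayer_eq_insert {k : ℕ} (a b : Fin n) (ha : a.val = k) (hb : b.val + k + 1 = n)
    (hk : 2 * k + 2 ≤ n) :
    middleLayer n k = insert b (insert a (middleLayer n (k + 1))) := by
  ext i
  simp only [middleLayer, Set.mem_ofPred_eq, Set.mem_insert_iff, Fin.ext_iff]
  omega

/-- Deleting the first and the last vertex of `minGraph n` leaves `minGraph (n - 2)`; the first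
vertex has the last two as its only neighbours, and these two dominate. -/
theorem ncard_cyclicPerms_middleLayer_step {k : ℕ} (hk : 2 * k + 3 ≤ n) :
    (cyclicPerms (minGraph n) (middleLayer n k)).ncard =
      2 * (cyclicPerms (minGraph n) (middleLayer n (k + 1))).ncard := by
  rw [middleLayer_eq_insert (k := k) ⟨k, by omega⟩ ⟨n - 1 - k, by omega⟩ rfl (by simp only; omega)
    (by omega)]
  apply ncard_cyclicPerms_insert (p := ⟨n - 2 - k, by omega⟩)
  all_goals simp only [middleLayer, minGraph, Set.mem_ofPred_eq, ne_eq, Fin.ext_iff]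
  all_goals omega

theorem ncard_cyclicPerms_middleLayer (m k : ℕ) (hn : n = 2 * k + 1 + m) :
    (cyclicPerms (minGraph n) (middleLayer n k)).ncard = 2 ^ (m / 2) := by
  induction m using Nat.twoStepInduction generalizing k with
  | zero =>
    have : middleLayer n k = {⟨k, by omega⟩} := by
      ext i
      simp only [middleLayer, Set.mem_ofPred_eq, Set.mem_singleton_iff, Fin.ext_iff]
      omega
    rw [this, cyclicPerms_singleton, Set.ncard_singleton]
    rfl
  | one =>
    have : middleLayer n k = {⟨k, by omega⟩, ⟨k + 1, by omega⟩} := by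
      ext i
      simp only [middleLayer, Set.mem_ofPred_eq, Set.mem_insert_iff, Set.mem_singleton_iff,
        Fin.ext_iff]
      omega
    rw [this, cyclicPerms_pair, Set.ncard_singleton]
    · rfl
    · simp only [minGraph, ne_eq, Fin.ext_iff]
      omega
  | more m ih _ =>
    rw [ncard_cyclicPerms_middleLayer_step (by omega), ih (k + 1) (by omega)]
    rw [show (m + 2) / 2 = m / 2 + 1 by omega, pow_succ]
    ring

theorem numHamiltonCycles_minGraph (hn : 3 ≤ n) :
    numHamiltonCycles (minGraph n) = 2 ^ ((n - 3) / 2) := by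
  have h := ncard_cyclicPerms_univ (G := minGraph n) (by simpa using hn)
  rw [← middleLayer_zero, ncard_cyclicPerms_middleLayer (n - 1) 0 (by omega),
    show (n - 1) / 2 = (n - 3) / 2 + 1 by omega, pow_succ] at h
  omega

theorem isHamiltonian_minGraph (hn : 3 ≤ n) : (minGraph n).IsHamiltonian := by
  rw [isHamiltonian_iff_nonempty_cyclicPerms (by simpa using hn), ← middleLayer_zero,
    ← Set.ncard_pos, ncard_cyclicPerms_middleLayer (n - 1) 0 (by omega)]
  positivity

theorem isThresholdGraph_minGraph (hn : 3 ≤ n) : IsThresholdGraph (minGraph n) := by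
  refine ⟨fun i => (i.val : ℝ) + 1, n - 1 / 2, fun i => by positivity, ?_, fun u v huv => ?_⟩
  · have : (3 : ℝ) ≤ n := by exact_mod_cast hn
    linarith
  · simp only [minGraph, ne_eq, huv, not_false_eq_true, true_and]
    constructor
    · intro h
      have : (n : ℝ) ≤ (u.val + 1) + (v.val + 1) := by exact_mod_cast h
      linarith
    · intro h
      by_contra hc
      have : ((u.val + 1) + (v.val + 1) + 1 : ℝ) ≤ n := by exact_mod_cast Nat.not_le.1 hc
      linarith

end MinGraph

/-! ### The degree sequence -/

section DegreeSequence

variable {n : ℕ}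

open Classical in
theorem degree_minGraph (hn : 3 ≤ n) (i : Fin n) :
    (minGraph n).degree i =
      if i.val + 1 = n then n - 1 else if 2 * (i.val + 1) < n then i.val + 2 else i.val + 1 := by
  have h : (minGraph n).neighborFinset i = (Finset.Ici ⟨n - 2 - i.val, by omega⟩).erase i := by
    ext j
    rw [SimpleGraph.mem_neighborFinset]
    simp only [minGraph, Finset.mem_erase, Finset.mem_Ici,
      Fin.le_def, Fin.ext_iff, ne_eq]
    omega
  rw [← SimpleGraph.card_neighborFinset_eq_degree, h, Finset.card_erase_eq_ite, Fin.card_Ici]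
  simp only [Finset.mem_Ici, Fin.le_def]
  split_ifs <;> omega

theorem degreeSequence_minGraph (hn : 3 ≤ n) :
    degreeSequence (minGraph n) = minDegreeSequence n := by
  classical
  obtain ⟨h, r, rfl, hh⟩ : ∃ h r, n = h + (1 + r) + 1 ∧ (n + 1) / 2 = h + 1 :=
    ⟨(n - 1) / 2, n - 2 - (n - 1) / 2, by omega, by omega⟩
  set n := h + (1 + r) + 1 with hn'
  set d : ℕ → ℕ := fun i =>
    if i + 1 = n then n - 1 else if 2 * (i + 1) < n then i + 2 else i + 1 with hd
  have hval : (Finset.univ : Finset (Fin n)).val.map Fin.val = Multiset.range n := by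
    have := congrArg Finset.val (Fin.map_valEmbedding_univ (n := n))
    rw [Finset.map_val] at this
    exact this.trans (by rw [Nat.Iio_eq_range]; rfl)
  have h1 : degreeSequence (minGraph n) = (Multiset.range n).map d := by
    rw [← hval, Multiset.map_map, degreeSequence]
    exact Multiset.map_congr rfl fun i _ => by simp [hd, degree_minGraph hn]
  have h2 : Multiset.Icc 2 (n - 1) = (Multiset.range (h + r)).map (2 + ·) := by
    show ((List.range' 2 (n - 1 + 1 - 2) : List ℕ) : Multiset ℕ) = _
    rw [List.range'_eq_map_range, show n - 1 + 1 - 2 = h + r by omega]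
    rfl
  -- the values at the first `h` vertices, at vertex `h`, at the next `r` and at the last one
  rw [h1, minDegreeSequence, h2, hh, hn', Multiset.range_succ, Multiset.range_add h (1 + r),
    Multiset.range_add 1 r, Multiset.range_add h r]
  simp only [Multiset.map_cons, Multiset.map_add, Multiset.map_map]
  have e1 : (Multiset.range h).map d = (Multiset.range h).map (2 + ·) :=
    Multiset.map_congr rfl fun i hi => by
      have := Multiset.mem_range.1 hi
      simp only [hd]
      split_ifs <;> omega
  have e2 : (Multiset.range 1).map (d ∘ (h + ·)) = {h + 1} := by
    simp [hd]
    split_ifs <;> omega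
  have e3 : (Multiset.range r).map ((d ∘ (h + ·)) ∘ (1 + ·)) =
      (Multiset.range r).map ((2 + ·) ∘ (h + ·)) :=
    Multiset.map_congr rfl fun i hi => by
      have := Multiset.mem_range.1 hi
      simp only [hd, Function.comp]
      split_ifs <;> omega
  have e4 : d (h + (1 + r)) = n - 1 := by simp [hd, hn']
  change d _ ::ₘ (Multiset.map d _ + (Multiset.map (d ∘ (h + ·)) _ +
    Multiset.map ((d ∘ (h + ·)) ∘ (1 + ·)) _)) = _
  rw [e1, e2, e3, e4]
  simp only [Multiset.insert_eq_cons, ← Multiset.singleton_add]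
  abel

theorem card_toFinset_minDegreeSequence (hn : 3 ≤ n) :
    (minDegreeSequence n).toFinset.card = n - 2 := by
  have : (minDegreeSequence n).toFinset = Finset.Icc 2 (n - 1) := by
    ext k
    simp only [minDegreeSequence, Multiset.mem_toFinset, Multiset.mem_add, Multiset.mem_Icc,
      Multiset.insert_eq_cons, Multiset.mem_cons, Multiset.mem_singleton, Finset.mem_Icc]
    omega
  rw [this, Nat.card_Icc]
  omega

theorem exists_equiv_of_map_univ_eq {α β γ : Type*} [Fintype α] [Fintype β] {f : α → γ}
    {g : β → γ} (h : Finset.univ.val.map f = Finset.univ.val.map g) :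
    ∃ e : α ≃ β, ∀ a, g (e a) = f a := by
  classical
  have hc : ∀ c, Nonempty ({a // f a = c} ≃ {b // g b = c}) := fun c => by
    rw [← Fintype.card_eq, Fintype.card_subtype, Fintype.card_subtype]
    have := congrArg (Multiset.count c) h
    rw [Multiset.count_map, Multiset.count_map] at this
    simpa only [Finset.card, Finset.filter_val, eq_comm] using this
  exact ⟨Equiv.ofFiberEquiv fun c => (hc c).some, fun a => Equiv.ofFiberEquiv_map _ a⟩

open Classical in
/-- A graph on the vertices of `minGraph n` with the same degree at each vertex is `minGraph n`.
By induction on `k`, the `k`-th vertices from either end have the right neighbours: the one from the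
top avoids the early bottom vertices, so it has no neighbour too many, and the one from the bottom
is joined to the late top vertices, so it has no neighbour too few. -/
theorem eq_minGraph_of_degree_eq {G : SimpleGraph (Fin n)}
    (hG : ∀ i, G.degree i = (minGraph n).degree i) : G = minGraph n := by
  have key : ∀ k (i : Fin n), (i.val + 1 = k ∨ i.val + k + 1 = n) →
      G.neighborFinset i = (minGraph n).neighborFinset i := by
    intro k
    induction k using Nat.strong_induction_on with
    | _ k ih =>
      have ih' : ∀ i : Fin n, (i.val + 1 < k ∨ n < i.val + k + 1) → ∀ j,
          G.Adj i j ↔ (minGraph n).Adj i j := fun i hi j => by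
        have : G.neighborFinset i = (minGraph n).neighborFinset i := by
          rcases hi with hi | hi
          · exact ih _ hi i (Or.inl rfl)
          · exact ih (n - 1 - i.val) (by omega) i (Or.inr (by omega))
        rw [← SimpleGraph.mem_neighborFinset, this, SimpleGraph.mem_neighborFinset]
      have top : ∀ i : Fin n, i.val + k + 1 = n →
          G.neighborFinset i = (minGraph n).neighborFinset i := by
        intro i hi
        refine Finset.eq_of_subset_of_card_le (fun j hj => ?_) (hG i).ge
        rw [SimpleGraph.mem_neighborFinset] at hj ⊢
        by_cases hjk : j.val + 1 < k
        · exact ((ih' j (Or.inl hjk) i).1 hj.symm).symm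
        · exact ⟨hj.ne, by omega⟩
      rintro i (hi | hi)
      · refine (Finset.eq_of_subset_of_card_le (fun j hj => ?_) (hG i).le).symm
        rw [SimpleGraph.mem_neighborFinset] at hj ⊢
        have := hj.2
        by_cases hjk : j.val + k + 1 = n
        · rw [SimpleGraph.adj_comm, ← SimpleGraph.mem_neighborFinset, top j hjk,
            SimpleGraph.mem_neighborFinset]
          exact hj.symm
        · exact ((ih' j (Or.inr (by omega)) i).2 hj.symm).symm
      · exact top i hi
  ext i j
  rw [← SimpleGraph.mem_neighborFinset, key _ i (Or.inl rfl), SimpleGraph.mem_neighborFinset]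

theorem nonempty_iso_minGraph {V : Type*} [Fintype V] {H : SimpleGraph V}
    (h : degreeSequence H = degreeSequence (minGraph n)) : Nonempty (H ≃g minGraph n) := by
  classical
  obtain ⟨e, he⟩ := exists_equiv_of_map_univ_eq h
  let φ := SimpleGraph.Iso.map e H
  have : H.map e = minGraph n := eq_minGraph_of_degree_eq fun i => by
    have h1 := φ.degree_eq (e.symm i)
    have h2 : φ (e.symm i) = i := e.apply_symm_apply i
    rw [h2] at h1
    have h3 := he (e.symm i)
    rw [e.apply_symm_apply] at h3
    rw [h3, ← h1]
    congr!
  exact ⟨this ▸ φ⟩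

end DegreeSequence

/-! ### Hamiltonian threshold graphs -/

section Threshold

variable {n : ℕ} {G : SimpleGraph (Fin n)}

/-- In a hamiltonian threshold graph with vertices in order of increasing weight, the `i`-th vertex
from the bottom is adjacent to the `i+1`-st from the top if it lies below it. Otherwise the bottom
`i` vertices would have all their neighbours among the top `i`, and a Hamilton cycle would alternate
between these two sets and never leave them. -/
theorem adj_of_isCyclicOn {f : Fin n → ℝ} {t : ℝ} (hf : Monotone f)
    (hG : ∀ u v, u ≠ v → (G.Adj u v ↔ f u + f v > t)) {σ : Perm (Fin n)}
    (hσ : IsCyclicOn σ Set.univ) (hadj : ∀ v, G.Adj v (σ v)) {i j : Fin n} (hij : i < j)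
    (hn : i.val + j.val + 2 = n) : G.Adj i j := by
  by_contra hc
  have hle : f i + f j ≤ t := not_lt.1 fun h => hc ((hG i j hij.ne).2 h)
  have nbr : ∀ a b, a ≤ i → G.Adj a b → j < b := fun a b ha hab => by
    by_contra hb
    have h1 := (hG a b hab.ne).1 hab
    linarith [hf ha, hf (not_lt.1 hb)]
  have hsub : (Finset.Iic i).map σ⁻¹.toEmbedding ⊆ Finset.Ioi j := fun b hb => by
    obtain ⟨a, ha, rfl⟩ := Finset.mem_map.1 hb
    have h1 := hadj (σ⁻¹ a)
    rw [show σ (σ⁻¹ a) = a by simp] at h1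
    exact Finset.mem_Ioi.2 (nbr _ _ (Finset.mem_Iic.1 ha) h1.symm)
  have heq := Finset.eq_of_subset_of_card_le hsub (by
    rw [Finset.card_map, Fin.card_Ioi, Fin.card_Iic]; omega)
  have := hσ.2 {v | v ≤ i ∨ j < v} (Set.subset_univ _) ⟨i, Or.inl le_rfl⟩ (by
    rintro v (hv | hv)
    · exact Or.inr (nbr _ _ hv (hadj v))
    · obtain ⟨a, ha, hav⟩ := Finset.mem_map.1 (heq.symm ▸ Finset.mem_Ioi.2 hv)
      left
      have : σ v = a := (Perm.inv_eq_iff_eq.1 hav).symm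
      exact this ▸ Finset.mem_Iic.1 ha)
  rcases Set.eq_univ_iff_forall.1 this j with h | h
  · exact absurd hij (not_lt.2 h)
  · exact lt_irrefl _ h

theorem minGraph_le_of_monotone (hn : 3 ≤ n) {f : Fin n → ℝ} {t : ℝ} (hf : Monotone f)
    (hG : ∀ u v, u ≠ v → (G.Adj u v ↔ f u + f v > t))
    (hne : (cyclicPerms G Set.univ).Nonempty) : minGraph n ≤ G := by
  obtain ⟨σ, hσ, hadj⟩ := hne
  have hmove := hσ.apply_ne (by simpa using hn)
  have main : ∀ x y : Fin n, x < y → n ≤ x.val + 1 + (y.val + 1) → G.Adj x y := by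
    intro x y hxy h
    obtain ⟨i, j, hij, hs, hix, hjy⟩ : ∃ i j : Fin n, i < j ∧ i.val + j.val + 2 = n ∧
        i ≤ x ∧ j ≤ y := by
      simp only [Fin.lt_def, Fin.le_def] at hxy ⊢
      by_cases h2 : 2 * (x.val + 1) < n
      · exact ⟨x, ⟨n - 2 - x.val, by omega⟩, by simp only; omega, by simp only; omega, le_rfl,
          by simp only; omega⟩
      · exact ⟨⟨(n - 1) / 2 - 1, by omega⟩, ⟨n - 1 - (n - 1) / 2, by omega⟩,
          by simp only; omega, by simp only; omega, by simp only; omega, by simp only; omega⟩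
    have h1 := (hG i j hij.ne).1
      (adj_of_isCyclicOn hf hG hσ (fun v => hadj v (hmove v)) hij hs)
    exact (hG x y hxy.ne).2 (by linarith [hf hix, hf hjy])
  rintro x y ⟨hxy, h⟩
  rcases lt_or_gt_of_ne hxy with h1 | h1
  · exact main x y h1 h
  · exact (main y x h1 (by omega)).symm

/-- A threshold graph can be carried over to `Fin n` with its vertices in order of increasing
weight. -/
theorem exists_iso_monotone {V : Type*} [Fintype V] (G : SimpleGraph V)
    (hV : Fintype.card V = n) (hG : IsThresholdGraph G) :
    ∃ (H : SimpleGraph (Fin n)) (f : Fin n → ℝ) (t : ℝ), Nonempty (G ≃g H) ∧ Monotone f ∧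
      ∀ u v, u ≠ v → (H.Adj u v ↔ f u + f v > t) := by
  obtain ⟨f, t, -, -, h⟩ := hG
  let e₀ : Fin n ≃ V := (Fintype.equivFinOfCardEq hV).symm
  let e : Fin n ≃ V := (Tuple.sort (f ∘ e₀)).trans e₀
  refine ⟨G.comap e, f ∘ e, t, ⟨(SimpleGraph.Iso.comap e G).symm⟩,
    Tuple.monotone_sort (f ∘ e₀), fun u v huv => ?_⟩
  exact h _ _ (e.injective.ne huv)

/-- A graph that contains `minGraph n` and one more edge, joining two vertices whose numbers (from
`1`) add up to `n - 1`, has a Hamilton cycle through this edge: insert the lower end `i` of the edge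
and the vertex `n - i` after the upper end `j` into a cycle of the vertices between these two,
and then the vertices further out in pairs, which keeps the edge. -/
theorem exists_cyclicPerm_apply_eq (hG : minGraph n ≤ G) {i j : Fin n} (hij : i < j)
    (hn : i.val + j.val + 3 = n) (hadj : G.Adj i j) :
    ∃ σ ∈ cyclicPerms G Set.univ, σ j = i := by
  have hdom : ∀ (k : ℕ) (b v : Fin n), b.val + k + 1 = n → v ∈ middleLayer n (k + 1) →
      G.Adj b v := fun k b v hb hv => hG ⟨by
        rintro rfl; have := hv.2; omega, by have := hv.1; omega⟩
  have step : ∀ k d, d + k = i.val → ∃ σ ∈ cyclicPerms G (middleLayer n k), σ j = i := by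
    intro k d
    induction d generalizing k with
    | zero =>
      intro hk
      have hij' : i.val < j.val := hij
      obtain ⟨τ, hτ⟩ : (cyclicPerms (minGraph n) (middleLayer n (k + 1))).Nonempty := by
        rw [← Set.ncard_pos, ncard_cyclicPerms_middleLayer (n - 2 * (k + 1) - 1) _ (by omega)]
        positivity
      let b : Fin n := ⟨n - 1 - k, by omega⟩
      have hb : b.val + k + 1 = n := by simp only [b]; omega
      have hj : j ∈ middleLayer n (k + 1) := ⟨by omega, by omega⟩
      have hi : i ∉ middleLayer n (k + 1) := fun h => by have := h.1; omega
      have hbn : b ∉ middleLayer n (k + 1) := fun h => by have := h.2; omega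
      have hib : G.Adj i b := hG ⟨by rw [ne_eq, Fin.ext_iff]; omega, by omega⟩
      refine ⟨τ * swap j i * swap i b, ?_, ?_⟩
      · rw [middleLayer_eq_insert i b (by omega) hb (by omega)]
        exact insert_mem_cyclicPerms (cyclicPerms_mono hG _ hτ) hj hi hbn hadj.symm hib
          fun v hv => hdom k b v hb hv
      · exact (insert_apply hij.ne' (fun e : j = b => hbn (e ▸ hj)) hib.ne (hτ.1.1 i hi)
          (hτ.1.1 b hbn)).1
    | succ d ih =>
      intro hk
      have hij' : i.val < j.val := hij
      obtain ⟨τ, hτ, hτj⟩ := ih (k + 1) (by omega)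
      let a : Fin n := ⟨k, by omega⟩
      let b : Fin n := ⟨n - 1 - k, by omega⟩
      let p : Fin n := ⟨n - 2 - k, by omega⟩
      have ha : a.val = k := rfl
      have hb : b.val + k + 1 = n := by simp only [b]; omega
      have hp : p.val + k + 2 = n := by simp only [p]; omega
      have hpm : p ∈ middleLayer n (k + 1) := ⟨by omega, by omega⟩
      have han : a ∉ middleLayer n (k + 1) := fun h => by have := h.1; omega
      have hbn : b ∉ middleLayer n (k + 1) := fun h => by have := h.2; omega
      have hab : G.Adj a b := hG ⟨by rw [ne_eq, Fin.ext_iff]; omega, by omega⟩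
      have hpa : G.Adj p a := hG ⟨by rw [ne_eq, Fin.ext_iff]; omega, by omega⟩
      refine ⟨τ * swap p a * swap a b, ?_, ?_⟩
      · rw [middleLayer_eq_insert a b ha hb (by omega)]
        exact insert_mem_cyclicPerms hτ hpm han hbn hpa hab fun v hv => hdom k b v hb hv
      · rw [(insert_apply hpa.ne (fun e : p = b => hbn (e ▸ hpm)) hab.ne (hτ.1.1 a han)
          (hτ.1.1 b hbn)).2.2.2 j _ _ _, hτj]
        all_goals rw [ne_eq, Fin.ext_iff]; omega
  rw [← middleLayer_zero]
  exact step 0 i.val (by omega)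

/-- A threshold graph that properly contains `minGraph n` has an edge that is one short of being an
edge of `minGraph n`, since raising an end of an edge gives an edge. -/
theorem exists_adj_of_ne {f : Fin n → ℝ} {t : ℝ} (hf : Monotone f)
    (hG : ∀ u v, u ≠ v → (G.Adj u v ↔ f u + f v > t)) (hle : minGraph n ≤ G)
    (hne : G ≠ minGraph n) : ∃ i j : Fin n, i < j ∧ i.val + j.val + 3 = n ∧ G.Adj i j := by
  obtain ⟨x, y, hxy, hx⟩ : ∃ x y : Fin n, x < y ∧ G.Adj x y ∧ x.val + y.val + 3 ≤ n := by
    by_contra! hc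
    refine hne (le_antisymm (fun x y hxy => ⟨hxy.ne, ?_⟩) hle)
    rcases lt_or_gt_of_ne hxy.ne with h | h
    · have := hc x y h hxy
      omega
    · have := hc y x h hxy.symm
      omega
  have hxy' : x.val < y.val := hxy
  have hlt : x < ⟨n - 3 - x.val, by omega⟩ := by rw [Fin.lt_def]; simp only; omega
  refine ⟨x, ⟨n - 3 - x.val, by omega⟩, hlt, by simp only; omega, (hG _ _ hlt.ne).2 ?_⟩
  have h1 := (hG x y hxy.ne).1 hx.1
  have h2 : f y ≤ f ⟨n - 3 - x.val, by omega⟩ := hf (by rw [Fin.le_def]; simp only; omega)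
  linarith

theorem numHamiltonCycles_threshold {V : Type*} [Fintype V] [DecidableEq V] (G : SimpleGraph V)
    (hn : 3 ≤ n) (hV : Fintype.card V = n) (hG : IsThresholdGraph G) (hH : G.IsHamiltonian) :
    2 ^ ((n - 3) / 2) ≤ numHamiltonCycles G ∧
      (numHamiltonCycles G = 2 ^ ((n - 3) / 2) ↔ Nonempty (G ≃g minGraph n)) := by
  have hV3 : 3 ≤ Fintype.card V := hV ▸ hn
  have hn3 : 3 ≤ Fintype.card (Fin n) := by simpa using hn
  obtain ⟨H, f, t, ⟨e⟩, hf, hadj⟩ := exists_iso_monotone G hV hG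
  have hne : (cyclicPerms H Set.univ).Nonempty := by
    rw [isHamiltonian_iff_nonempty_cyclicPerms hV3, ← Set.ncard_pos] at hH
    rw [← Set.ncard_pos]
    exact hH.trans_le (ncard_cyclicPerms_le_of_iso e)
  have hle := minGraph_le_of_monotone hn hf hadj hne
  have hsub := cyclicPerms_mono hle Set.univ
  have hcard := Set.ncard_le_ncard hsub
  rw [ncard_cyclicPerms_univ hn3, ncard_cyclicPerms_univ hn3] at hcard
  rw [← numHamiltonCycles_minGraph hn, numHamiltonCycles_congr hV3 e]
  refine ⟨by omega, fun h => ?_, fun ⟨e'⟩ => ?_⟩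
  · by_contra hiso
    have hneq : H ≠ minGraph n := fun h => hiso ⟨h ▸ e⟩
    obtain ⟨i, j, hij, hs, hx⟩ := exists_adj_of_ne hf hadj hle hneq
    obtain ⟨σ, hσ, hσj⟩ := exists_cyclicPerm_apply_eq hle hij hs hx
    have hnot : σ ∉ cyclicPerms (minGraph n) Set.univ := fun hm => by
      have h1 := hm.2 j (by rw [hσj]; exact hij.ne)
      rw [hσj] at h1
      have := h1.2
      omega
    have := Set.ncard_lt_ncard (Set.ssubset_iff_exists.2 ⟨hsub, σ, hσ, hnot⟩)
    rw [ncard_cyclicPerms_univ hn3, ncard_cyclicPerms_univ hn3] at this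
    omega
  · exact numHamiltonCycles_congr hn3 (e.symm.trans e')

end Threshold

theorem theorem6 :
    (∀ n : ℕ, 3 ≤ n →
      -- `minGraph n` is, up to isomorphism, the graph with the stated degree sequence,
      -- which has `n - 2` distinct degrees
      degreeSequence (minGraph n) = minDegreeSequence n ∧
      (minDegreeSequence n).toFinset.card = n - 2 ∧
      (∀ (V : Type*) [Fintype V] (H : SimpleGraph V),
        degreeSequence H = minDegreeSequence n → Nonempty (H ≃g minGraph n)) ∧
      -- it is a hamiltonian threshold graph
      IsThresholdGraph (minGraph n) ∧ (minGraph n).IsHamiltonian ∧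
      -- the minimum number of Hamilton cycles
      IsLeast {N : ℕ | ∃ G : SimpleGraph (Fin n),
        IsThresholdGraph G ∧ G.IsHamiltonian ∧ numHamiltonCycles G = N} (2 ^ ((n - 3) / 2)) ∧
      -- it is attained by `minGraph n` and, up to isomorphism, by no other graph
      (∀ (V : Type*) [Fintype V] [DecidableEq V] (G : SimpleGraph V),
        Fintype.card V = n → IsThresholdGraph G → G.IsHamiltonian →
          2 ^ ((n - 3) / 2) ≤ numHamiltonCycles G ∧
          (numHamiltonCycles G = 2 ^ ((n - 3) / 2) ↔ Nonempty (G ≃g minGraph n)))) ∧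
    -- the recursion for the number of Hamilton cycles of `minGraph n`
    (∀ k : ℕ, 2 ≤ k →
      numHamiltonCycles (minGraph (2 * k - 1)) = numHamiltonCycles (minGraph (2 * k)) ∧
      numHamiltonCycles (minGraph (2 * k + 1)) = 2 * numHamiltonCycles (minGraph (2 * k))) := by
  refine ⟨fun n hn => ⟨degreeSequence_minGraph hn, card_toFinset_minDegreeSequence hn,
    fun V _ H h => nonempty_iso_minGraph (h.trans (degreeSequence_minGraph hn).symm),
    isThresholdGraph_minGraph hn, isHamiltonian_minGraph hn, ⟨?_, ?_⟩,
    fun V _ _ G hV hG hH => numHamiltonCycles_threshold G hn hV hG hH⟩, fun k hk => ⟨?_, ?_⟩⟩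
  · exact ⟨minGraph n, isThresholdGraph_minGraph hn, isHamiltonian_minGraph hn,
      numHamiltonCycles_minGraph hn⟩
  · rintro N ⟨G, hG, hH, rfl⟩
    exact (numHamiltonCycles_threshold G hn (Fintype.card_fin n) hG hH).1
  · rw [numHamiltonCycles_minGraph (by omega), numHamiltonCycles_minGraph (by omega)]
    congr 1
    omega
  · rw [numHamiltonCycles_minGraph (by omega), numHamiltonCycles_minGraph (by omega), ← pow_succ']
    congr 1
    omega
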